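/- Let $\lambda\in(0,1)$ and $t\in\mathbb R$. For $n\ge 1$ put $W_n=(\lambda^n,\lambda^{n-1}]$, and let $F_\lambda:(0,1]\to(0,1]$ be given by $F_\lambda(x)=\frac{x-\lambda}{1-\lambda}$ on $W_1$ and $F_\lambda(x)=\frac{x-\lambda^n}{\lambda(1-\lambda)}$ on $W_n$, $n\ge 2$. Let $\Phi_t=-t\log|F_\lambda'|$, where $F_\lambda'$ is the left derivative at the points $\lambda^n$, $n\ge 0$. For $p\in\mathbb R$, a Borel probability measure $m$ on $(0,1]$ is called $(t,p)$-conformal if $m(F_\lambda(A))=\int_A e^{p-\Phi_t}\,dm$ for every Borel set $A\subset(0,1]$ on which $F_\lambda$ is one-to-one. The conformal pressure is $$P_{\mathrm{Conf}}(\Phi_t)=\inf\{p\in\mathbb R:\text{ there is a }(t,p)\text{-conformal measure}\}\in[-\infty,\infty].$$ A Borel set $W$ is wandering if the sets $F_\lambda^{-n}(W)$, $n\ge0$, are pairwise disjoint. A Borel measure $\mu$ is non-singular if, for every Borel set $A$, $\mu(A)=0$ if and only if $\mu(F_\lambda^{-1}(A))=0$. A non-singular measure $\mu$ is conservative if every wandering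 set has $\mu$-measure $0$, and dissipative if $(0,1]$ is, up to a $\mu$-null set, a countable union of wandering sets. **Theorem.** Let $\psi(t)=\frac{(1-\lambda)^t}{1-\lambda^t}$. Then $$P_{\mathrm{Conf}}(\Phi_t)=\begin{cases}\log\psi(t)&\text{if }\lambda^t\le\frac12,\\ \log[4\lambda^t(1-\lambda)^t]&\text{if }\lambda^t\ge\frac12.\end{cases}$$ If $p=P_{\mathrm{Conf}}(\Phi_t)$, then there exists a $(t,p)$-conformal measure, and every such measure is conservative if $\lambda^t\le\frac12$ and dissipative if $\lambda^t>\frac12$. If $p\in\mathbb R$ and $p\ne P_{\mathrm{Conf}}(\Phi_t)$, then every $(t,p)$-conformal measure is dissipative. -/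

import Mathlib

open MeasureTheory

noncomputable section

namespace Dyn

variable {X : Type*} [MeasurableSpace X]

/-- A Borel probability measure `m` is `φ`-conformal for `f` if
`m (f A) = ∫_A e^{-φ} dm` for every measurable set `A` on which `f` is one-to-one. -/
structure IsConformal (f : X → X) (φ : X → ℝ) (m : Measure X) : Prop where
  isProbabilityMeasure : IsProbabilityMeasure m
  measure_image : ∀ A : Set X, MeasurableSet A → Set.InjOn f A →
    m (f '' A) = ∫⁻ x in A, ENNReal.ofReal (Real.exp (-(φ x))) ∂m

/-- The conformal pressure: the infimum of all real `p` for which there is a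
`(φ - p)`-conformal measure, taken in the extended reals. -/
def confPressure (f : X → X) (φ : X → ℝ) : EReal :=
  sInf ((fun p : ℝ => (p : EReal)) ''
    {p : ℝ | ∃ m : Measure X, IsConformal f (fun x => φ x - p) m})

/-- `μ (A) = 0` if and only if `μ (f⁻¹ A) = 0`, for all measurable `A`. -/
def IsNonSingular (f : X → X) (μ : Measure X) : Prop :=
  ∀ A : Set X, MeasurableSet A → (μ A = 0 ↔ μ (f ⁻¹' A) = 0)

/-- A measurable set is wandering if its preimages `f⁻ⁿ W`, `n ≥ 0`, are pairwise disjoint. -/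
def IsWandering (f : X → X) (W : Set X) : Prop :=
  MeasurableSet W ∧ Pairwise (fun i j : ℕ => Disjoint (f^[i] ⁻¹' W) (f^[j] ⁻¹' W))

/-- A non-singular measure is conservative if every wandering set is null. -/
def IsConservative (f : X → X) (μ : Measure X) : Prop :=
  IsNonSingular f μ ∧ ∀ W : Set X, IsWandering f W → μ W = 0

/-- A non-singular measure is (totally) dissipative if, up to a null set, the whole space is a
countable union of wandering sets. -/
def IsDissipative (f : X → X) (μ : Measure X) : Prop :=
  IsNonSingular f μ ∧
    ∃ W : ℕ → Set X, (∀ n, IsWandering f (W n)) ∧ μ (⋃ n, W n)ᶜ = 0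

end Dyn

namespace PLMap

/-- The half-open unit interval `(0, 1]`. -/
abbrev X : Type := Set.Ioc (0 : ℝ) 1

/-- The intervals `W_n = (lam ^ n, lam ^ (n - 1)]`, for `n ≥ 1`. -/
def W (lam : ℝ) (n : ℕ) : Set ℝ := Set.Ioc (lam ^ n) (lam ^ (n - 1))

/-- The index `n ≥ 1` of the interval `W_n` that contains `x ∈ (0, 1]`. -/
def idx (lam x : ℝ) : ℕ := sInf {n : ℕ | 1 ≤ n ∧ x ∈ W lam n}

/-- The formula of the map: `(x - lam) / (1 - lam)` on `W_1` and
`(x - lam ^ n) / (lam * (1 - lam))` on `W_n` for `n ≥ 2`. -/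
def mapReal (lam x : ℝ) : ℝ :=
  if idx lam x = 1 then (x - lam) / (1 - lam)
  else (x - lam ^ idx lam x) / (lam * (1 - lam))

theorem idx_spec {lam x : ℝ} (hl : lam ∈ Set.Ioo (0 : ℝ) 1) (hx : x ∈ Set.Ioc (0 : ℝ) 1) :
    1 ≤ idx lam x ∧ x ∈ W lam (idx lam x) := by
  have hex : ∃ n : ℕ, lam ^ n < x := exists_pow_lt_of_lt_one hx.1 hl.2
  classical
  have hne : {n : ℕ | 1 ≤ n ∧ x ∈ W lam n}.Nonempty := by
    have h1 := Nat.find_spec hex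
    have hpos : 1 ≤ Nat.find hex := by
      rcases Nat.eq_zero_or_pos (Nat.find hex) with h | h
      · rw [h, pow_zero] at h1
        exact absurd h1 (not_lt.mpr hx.2)
      · exact h
    refine ⟨Nat.find hex, hpos, h1, not_lt.mp (Nat.find_min hex ?_)⟩
    omega
  exact Nat.sInf_mem hne

theorem mapReal_mem {lam x : ℝ} (hl : lam ∈ Set.Ioo (0 : ℝ) 1) (hx : x ∈ Set.Ioc (0 : ℝ) 1) :
    mapReal lam x ∈ Set.Ioc (0 : ℝ) 1 := by
  obtain ⟨h1, h2, h3⟩ := idx_spec hl hx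
  have hl0 := hl.1
  have hl1 : 0 < 1 - lam := sub_pos.mpr hl.2
  unfold mapReal
  split_ifs with h
  · rw [h, pow_one] at h2
    refine ⟨div_pos (sub_pos.mpr h2) hl1, ?_⟩
    rw [div_le_one hl1]
    linarith [hx.2]
  · refine ⟨div_pos (sub_pos.mpr h2) (mul_pos hl0 hl1), ?_⟩
    rw [div_le_one (mul_pos hl0 hl1)]
    obtain ⟨k, hk⟩ : ∃ k, idx lam x = k + 2 := ⟨idx lam x - 2, by omega⟩
    rw [hk] at h3 ⊢
    have e : k + 2 - 1 = k + 1 := by omega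
    rw [e] at h3
    have hk1 : lam ^ k ≤ 1 := pow_le_one₀ hl0.le hl.2.le
    calc x - lam ^ (k + 2) ≤ lam ^ (k + 1) - lam ^ (k + 2) := by linarith
      _ = lam ^ k * (lam * (1 - lam)) := by ring
      _ ≤ 1 * (lam * (1 - lam)) := mul_le_mul_of_nonneg_right hk1 (mul_pos hl0 hl1).le
      _ = lam * (1 - lam) := one_mul _

/-- The countably piecewise linear map `F_lam : (0, 1] → (0, 1]`. -/
def F (lam : ℝ) (hl : lam ∈ Set.Ioo (0 : ℝ) 1) (x : X) : X :=
  ⟨mapReal lam x, mapReal_mem hl x.2⟩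

/-- The geometric potential `Φ_t = -t log |F_lam'|`. The derivative is the left one: at the
discontinuity points `lam ^ n` it is the one-sided derivative of the branch that contains the
point, and elsewhere it is the ordinary derivative. -/
def Phi (lam t : ℝ) (x : X) : ℝ :=
  -t * Real.log |derivWithin (mapReal lam) (Set.Iic (x : ℝ)) x|

/-- `ψ(t) = (1 - lam) ^ t / (1 - lam ^ t)`. -/
def psi (lam t : ℝ) : ℝ := (1 - lam) ^ t / (1 - lam ^ t)

/-- A `(t, p)`-conformal measure is a `(Φ_t - p)`-conformal measure for `F_lam`. -/
def IsTPConformal (lam : ℝ) (hl : lam ∈ Set.Ioo (0 : ℝ) 1) (t p : ℝ) (m : Measure X) : Prop :=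
  Dyn.IsConformal (F lam hl) (fun x => Phi lam t x - p) m

end PLMap

end

/-!
Write `u = lam ^ t` and call `n - 1` the *level* of a point of `W_n`. On level `0` the map is onto,
and on level `j + 1` it is onto the set of points of level at least `j`; on every level it is
affine. Hence a probability measure `m` is `(t, p)`-conformal if and only if it is *Markov* with
weights `a, b, b, …`, where `a = e ^ (-p) * (1 - lam) ^ t` and `b = a * u`: on level `j`,
`m (F⁻¹ A)` is the `j`-th weight times the mass of the part of `A` in the image of level `j`
(`isTPConformal_iff`). Everything is then a matter of two linear recurrences.

*The range of `p`.* The tails `s j = m {level ≥ j}` are positive, `s 0 = 1`, `s 1 = 1 - a` and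
`s (j + 2) = s (j + 1) - b * s j`. The ratios of a positive solution satisfy `r ↦ 1 - b / r`, and
they start at `u` (put `u⁻¹` before `s 0`). If `r ^ 2 - r + b` is bounded below by a positive
constant on `(0, u]`, they decrease at least linearly and become negative; this excludes
`b > 1 / 4`, and, when `u ≤ 1 / 2`, also `a > 1 - u` (`weight_le_of_tail`). So `a` is at most
`criticalWeight u`, and equality there is the claimed pressure.

*Existence.* At the critical weight the recurrence has an explicit positive solution tending to
`0`, namely `u ^ j` or `(1 + (1 - 2 * a) * j) / 2 ^ j`. Cutting `(0, 1]` at the points `s j` and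
mapping each piece affinely gives a model of the same combinatorics (`IsCascade`) for which
Lebesgue measure is Markov. Two such models are related by a measurable semiconjugacy that
preserves levels, the increasing limit of `y ↦ s' (j + 1) + ω' j * h (map y)`
(`IsCascade.exists_semiconj`), and the conformal measure is the push-forward of Lebesgue measure.

*Recurrence.* For `A` contained in level `k` one has `m (F⁻ⁱ A) = ℓ_i k * m A`, where `ℓ_0 = 1` and
`ℓ_(i+1) k = a * ℓ_i 0 + b * ∑_{1 ≤ j ≤ k + 1} ℓ_i j`. If `∑ i, ℓ_i k` diverges for each `k`, a
wandering set of positive measure would have preimages of infinite total mass. If it converges for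
each `k`, then by Borel–Cantelli almost every orbit visits each level finitely often, and the sets
of points at their last visit to a level are wandering. Convergence follows from the existence of a
supersolution `G k = x⁻¹ ^ k`, where `x = 1 / 2` for `u > 1 / 2` and `x = 1 - u` for `u ≤ 1 / 2`,
`a < 1 - u`. In the remaining case `u ≤ 1 / 2`, `a = 1 - u`, the sum would be a nonnegative solution
of a second order recurrence all of whose solutions become negative (`not_summable_density`).
-/

namespace Cascade
open Filter Topology

/-! ### Iterates of the transfer operator on functions of the level -/

/-- The sequence `a, b, b, b, …`. -/
def weight (a b : ℝ) : ℕ → ℝ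
  | 0 => a
  | _ + 1 => b

@[simp] theorem weight_zero (a b : ℝ) : weight a b 0 = a := rfl
@[simp] theorem weight_succ (a b : ℝ) (j : ℕ) : weight a b (j + 1) = b := rfl

theorem weight_pos {a b : ℝ} (ha : 0 < a) (hb : 0 < b) (j : ℕ) : 0 < weight a b j := by
  cases j <;> simpa

/-- The operator `g ↦ (k ↦ ∑_{j ≤ k + 1} ω j * g j)`. -/
def transfer (ω g : ℕ → ℝ) (k : ℕ) : ℝ := ∑ j ∈ Finset.range (k + 2), ω j * g j

/-- The iterates of `transfer ω` on the constant function `1`. For a Markov measure with weights `ω`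
this is the density of the `i`-th push-forward, see `IsMarkov.measure_preimage_iterate`. -/
def density (ω : ℕ → ℝ) (i : ℕ) : ℕ → ℝ := (transfer ω)^[i] (fun _ => 1)

@[simp] theorem density_zero (ω : ℕ → ℝ) (k : ℕ) : density ω 0 k = 1 := rfl

theorem density_succ (ω : ℕ → ℝ) (i k : ℕ) :
    density ω (i + 1) k = transfer ω (density ω i) k := by
  simp only [density, Function.iterate_succ_apply']

theorem density_nonneg {ω : ℕ → ℝ} (hω : ∀ j, 0 < ω j) (i k : ℕ) : 0 ≤ density ω i k := by
  induction i generalizing k with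
  | zero => simp
  | succ i ih =>
    rw [density_succ]
    exact Finset.sum_nonneg fun j _ => mul_nonneg (hω j).le (ih j)

theorem transfer_succ (ω g : ℕ → ℝ) (k : ℕ) :
    transfer ω g (k + 1) = transfer ω g k + ω (k + 2) * g (k + 2) := by
  rw [transfer, Finset.sum_range_succ, transfer]

theorem transfer_mono {ω g g' : ℕ → ℝ} (hω : ∀ j, 0 < ω j) (h : ∀ j, g j ≤ g' j) (k : ℕ) :
    transfer ω g k ≤ transfer ω g' k :=
  Finset.sum_le_sum fun j _ => mul_le_mul_of_nonneg_left (h j) (hω j).le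

theorem transfer_sum (ω : ℕ → ℝ) (g : ℕ → ℕ → ℝ) (s : Finset ℕ) (k : ℕ) :
    transfer ω (fun j => ∑ i ∈ s, g i j) k = ∑ i ∈ s, transfer ω (g i) k := by
  simp only [transfer, Finset.mul_sum]
  exact Finset.sum_comm

/-- A nonnegative strict supersolution `G` dominates the potential of the constant `ε`. -/
theorem summable_density_of_transfer_add_le {ω G : ℕ → ℝ} (hω : ∀ j, 0 < ω j) {ε : ℝ}
    (hε : 0 < ε) (hG0 : ∀ k, 0 ≤ G k) (hG : ∀ k, transfer ω G k + ε ≤ G k) (k : ℕ) :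
    Summable fun i => density ω i k := by
  have key : ∀ N k, ∑ i ∈ Finset.range N, ε * density ω i k ≤ G k := by
    intro N
    induction N with
    | zero => simpa using hG0
    | succ N ih =>
      intro k
      have h1 : ∑ i ∈ Finset.range N, ε * density ω (i + 1) k
          = transfer ω (fun j => ∑ i ∈ Finset.range N, ε * density ω i j) k := by
        rw [transfer_sum]
        refine Finset.sum_congr rfl fun i _ => ?_
        simp only [density_succ, transfer, Finset.mul_sum]
        exact Finset.sum_congr rfl fun j _ => by ring
      rw [Finset.sum_range_succ', h1]
      have := transfer_mono hω ih k
      simp only [density_zero, mul_one]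
      linarith [hG k]
  have : Summable fun i => ε * density ω i k :=
    summable_of_sum_range_le (fun i => mul_nonneg hε.le (density_nonneg hω i k)) fun N => key N k
  exact (summable_mul_left_iff hε.ne').1 this

/-- The function `k ↦ x⁻¹ ^ k` is a strict supersolution. -/
theorem summable_density {a b x : ℝ} (ha : 0 < a) (hb : 0 < b) (hx : 0 < x)
    (hbx : b ≤ x * (1 - x)) (hax : a < x) (k : ℕ) :
    Summable fun i => density (weight a b) i k := by
  have hy : 0 < x⁻¹ := inv_pos.2 hx
  have hquad : x⁻¹ - 1 - b * x⁻¹ ^ 2 ≥ 0 := by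
    have : x⁻¹ - 1 - b * x⁻¹ ^ 2 = x⁻¹ ^ 2 * (x * (1 - x) - b) := by field_simp
    rw [this]
    exact mul_nonneg (by positivity) (by linarith)
  have hbx' : b * x⁻¹ ≤ 1 - x := by
    rw [← div_eq_mul_inv, div_le_iff₀ hx]
    linarith
  refine summable_density_of_transfer_add_le (G := fun k => x⁻¹ ^ k) (ε := 1 - a - b * x⁻¹)
    (weight_pos ha hb) (by linarith) (fun k => by positivity) (fun k => ?_) k
  induction k with
  | zero => simp [transfer, Finset.sum_range_succ]
  | succ k ih =>
    rw [transfer_succ, weight_succ]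
    have : x⁻¹ ^ k * (x⁻¹ - 1 - b * x⁻¹ ^ 2) ≥ 0 := mul_nonneg (by positivity) hquad
    have e : x⁻¹ ^ (k + 1) - x⁻¹ ^ k - b * x⁻¹ ^ (k + 2) = x⁻¹ ^ k * (x⁻¹ - 1 - b * x⁻¹ ^ 2) := by
      ring
    linarith

theorem density_zero_le {ω : ℕ → ℝ} (hω : ∀ j, 0 < ω j) (i k : ℕ) :
    density ω i 0 ≤ density ω i k := by
  cases i with
  | zero => simp
  | succ i =>
    simp only [density_succ]
    exact Finset.sum_le_sum_of_subset_of_nonneg (Finset.range_subset_range.2 (by omega))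
      fun j _ _ => mul_nonneg (hω j).le (density_nonneg hω i j)

theorem summable_density_of_summable {ω : ℕ → ℝ} (hω : ∀ j, 0 < ω j) {k : ℕ}
    (h : Summable fun i => density ω i k) (n : ℕ) : Summable fun i => density ω i n := by
  induction n with
  | zero => exact h.of_nonneg_of_le (fun i => density_nonneg hω i 0) (density_zero_le hω · k)
  | succ n ih =>
    have h1 : Summable fun i => (ω (n + 1))⁻¹ * density ω (i + 1) n :=
      ((summable_nat_add_iff 1).2 ih).mul_left _
    refine h1.of_nonneg_of_le (fun i => density_nonneg hω i _) fun i => ?_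
    have h2 : ω (n + 1) * density ω i (n + 1) ≤ density ω (i + 1) n := by
      rw [density_succ]
      exact Finset.single_le_sum (f := fun j => ω j * density ω i j)
        (fun j _ => mul_nonneg (hω j).le (density_nonneg hω i j)) (by simp)
    rw [inv_mul_eq_div, le_div_iff₀ (hω _)]
    linarith

theorem tsum_density_eq {ω : ℕ → ℝ} (h : ∀ k, Summable fun i => density ω i k) (k : ℕ) :
    ∑' i, density ω i k = 1 + transfer ω (fun j => ∑' i, density ω i j) k := by
  rw [(h k).tsum_eq_zero_add, density_zero]
  simp only [density_succ, transfer]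
  rw [Summable.tsum_finsetSum fun j _ => (h j).mul_left _]
  simp only [tsum_mul_left]

/-- Here the quadratic `x ^ 2 - x + b` has the roots `u ≤ 1 - u`. The sum `g` would be a nonnegative
solution of `g = 1 + transfer g`; splitting off the root `u` reduces this to a first order
recurrence, along which `(1 - u) ^ (k + 1) * g k` decreases by at least `1` at each step. -/
theorem not_summable_density {u : ℝ} (hu : 0 < u) (hu2 : u ≤ 1 / 2) (k : ℕ) :
    ¬ Summable fun i => density (weight (1 - u) (u * (1 - u))) i k := by
  intro hk
  have h1u : 0 < 1 - u := by linarith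
  have hω := weight_pos h1u (mul_pos hu h1u)
  have hs := summable_density_of_summable hω hk
  have hg0 : ∀ k, 0 ≤ ∑' i, density (weight (1 - u) (u * (1 - u))) i k :=
    fun k => tsum_nonneg fun i => density_nonneg hω i k
  have hg := tsum_density_eq hs
  set g : ℕ → ℝ := fun k => ∑' i, density (weight (1 - u) (u * (1 - u))) i k
  have e0 : g 0 = 1 + ((1 - u) * g 0 + u * (1 - u) * g 1) := by
    simpa [transfer, Finset.sum_range_succ] using hg 0
  have e1 : ∀ k, g (k + 1) - g k = u * (1 - u) * g (k + 2) := by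
    intro k
    have h1 : g (k + 1) = 1 + transfer (weight (1 - u) (u * (1 - u))) g (k + 1) := hg (k + 1)
    have h2 : g k = 1 + transfer (weight (1 - u) (u * (1 - u))) g k := hg k
    rw [transfer_succ, weight_succ] at h1
    linarith
  have d : ∀ k, (1 - u) ^ (k + 1) * (g k - u * g (k + 1)) = 1 + (1 - 2 * u) * g 0 := by
    intro k
    induction k with
    | zero => simp; linarith
    | succ k ih =>
      rw [← ih]
      linear_combination (1 - u) ^ (k + 1) * e1 k
  have v : ∀ k : ℕ, (1 - u) ^ (k + 1) * g k ≤ (1 - u) * g 0 - k := by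
    intro k
    induction k with
    | zero => simp
    | succ k ih =>
      have h1 : u * ((1 - u) ^ (k + 1) * g (k + 1)) ≤ u * g 0 - (k + 1) := by
        linarith [d k]
      have h2 : u * ((1 - u) ^ (k + 2) * g (k + 1))
          ≤ (1 - u) * (u * g 0 - (k + 1)) := by
        calc _ = (1 - u) * (u * ((1 - u) ^ (k + 1) * g (k + 1))) := by ring
          _ ≤ _ := mul_le_mul_of_nonneg_left h1 h1u.le
      have hk0 : (0 : ℝ) ≤ k + 1 := by positivity
      push_cast
      refine le_of_mul_le_mul_left (h2.trans ?_) hu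
      nlinarith [mul_nonneg hk0 (by linarith : 0 ≤ 1 - 2 * u)]
  obtain ⟨n, hn⟩ := exists_nat_gt ((1 - u) * g 0)
  have : 0 ≤ (1 - u) ^ (n + 1) * g n := mul_nonneg (by positivity) (hg0 n)
  linarith [v n]

/-! ### Positive solutions of the recurrence for the tails -/

/-- The ratios `r n = σ (n + 1) / σ n` satisfy `r n - r (n + 1) = (r n ^ 2 - r n + b) / r n`, so they
would decrease to below `0`. -/
theorem false_of_recurrence {b δ : ℝ} {σ : ℕ → ℝ} (hσ : ∀ n, 0 < σ n)
    (hrec : ∀ n, σ (n + 2) = σ (n + 1) - b * σ n) (hδ : 0 < δ)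
    (hquad : ∀ x, 0 < x → x ≤ σ 1 / σ 0 → δ ≤ x ^ 2 - x + b) : False := by
  set r : ℕ → ℝ := fun n => σ (n + 1) / σ n with hr
  have r0 : ∀ n, 0 < r n := fun n => div_pos (hσ _) (hσ _)
  have rrec : ∀ n, r (n + 1) = 1 - b / r n := by
    intro n
    have h1 := (hσ n).ne'
    have h2 := (hσ (n + 1)).ne'
    simp only [hr, hrec n]
    field_simp
  have key : ∀ n : ℕ, r n ≤ r 0 - n * (δ / r 0) := by
    intro n
    induction n with
    | zero => simp
    | succ n ih =>
      have hd : 0 ≤ δ / r 0 := (div_pos hδ (r0 0)).le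
      have hle : r n ≤ r 0 := ih.trans (sub_le_self _ (by positivity))
      have h1 : δ / r 0 ≤ δ / r n := by gcongr; exact r0 n
      have h2 : δ / r n ≤ (r n ^ 2 - r n + b) / r n :=
        div_le_div_of_nonneg_right (hquad _ (r0 n) hle) (r0 n).le
      have h3 : (r n ^ 2 - r n + b) / r n = r n - (1 - b / r n) := by
        field_simp [(r0 n).ne']
        ring
      rw [rrec]
      push_cast
      linarith
  obtain ⟨n, hn⟩ := exists_nat_gt (r 0 / (δ / r 0))
  rw [div_lt_iff₀ (div_pos hδ (r0 0))] at hn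
  linarith [key n, r0 n]

theorem weight_le_of_tail {a u : ℝ} {s : ℕ → ℝ} (ha : 0 < a) (hu : 0 < u) (hs : ∀ n, 0 < s n)
    (hs0 : s 0 = 1) (hrec : ∀ j, s j - s (j + 1) = weight a (a * u) j * s (j - 1)) :
    a * u ≤ 1 / 4 ∧ (u ≤ 1 / 2 → a ≤ 1 - u) := by
  -- with `u⁻¹` prepended, the recurrence holds from the first term on
  let σ : ℕ → ℝ := fun n => Nat.casesOn n u⁻¹ s
  have hσ : ∀ n, 0 < σ n := by
    rintro (_ | n)
    · exact inv_pos.2 hu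
    · exact hs n
  have hσrec : ∀ n, σ (n + 2) = σ (n + 1) - a * u * σ n := by
    rintro (_ | n)
    · have := hrec 0
      have e : a * u * u⁻¹ = a := by field_simp
      simp only [weight_zero, hs0] at this
      change s 1 = s 0 - a * u * u⁻¹
      rw [e, hs0]
      simp only [zero_add] at this
      linarith
    · have := hrec (n + 1)
      simp only [weight_succ, Nat.add_sub_cancel] at this
      change s (n + 2) = s (n + 1) - a * u * s n
      linarith
  have hratio : σ 1 / σ 0 = u := by simp [σ, hs0]
  constructor
  · by_contra! h
    exact false_of_recurrence hσ hσrec (sub_pos.2 h)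
      fun x _ _ => by nlinarith [sq_nonneg (x - 1 / 2)]
  · intro hu2
    by_contra! h
    refine false_of_recurrence (δ := u * (a - (1 - u))) hσ hσrec
      (mul_pos hu (sub_pos.2 h)) fun x hx hxu => ?_
    rw [hratio] at hxu
    nlinarith [mul_nonneg (sub_nonneg.2 hxu) (by linarith : 0 ≤ 1 - x - u)]

/-! ### Markov measures, conservativity and dissipativity -/

section Markov

variable {X Y : Type*} [MeasurableSpace X] [MeasurableSpace Y]

/-- The measure `m` is Markov for `f` with weights `ω`, with respect to the levels `κ`: on level `j`
the map `f` covers exactly the points of level at least `j - 1`, and its inverse branch there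
multiplies `m` by `ω j`. The condition `j ≤ κ x + 1` replaces `j - 1 ≤ κ x`. -/
structure IsMarkov (f : X → X) (κ : X → ℕ) (ω : ℕ → ℝ) (m : Measure X) : Prop where
  measurable_map : Measurable f
  measurable_level : Measurable κ
  measure_inter : ∀ (j : ℕ) (A : Set X), MeasurableSet A →
    m (f ⁻¹' A ∩ κ ⁻¹' {j}) = ENNReal.ofReal (ω j) * m (A ∩ {x | j ≤ κ x + 1})

namespace IsMarkov

variable {f : X → X} {κ : X → ℕ} {ω : ℕ → ℝ} {m : Measure X}

/-- A Markov measure is pushed forward to a Markov measure by a level preserving semiconjugacy. -/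
theorem map {g : Y → Y} {η : Y → ℕ} {ν : Measure Y} (hν : IsMarkov g η ω ν)
    (hf : Measurable f) (hκ : Measurable κ) {h : Y → X} (hh : Measurable h)
    (hlevel : ∀ y, κ (h y) = η y) (hmap : ∀ y, f (h y) = h (g y)) :
    IsMarkov f κ ω (ν.map h) where
  measurable_map := hf
  measurable_level := hκ
  measure_inter j A hA := by
    have h1 : MeasurableSet (κ ⁻¹' {j}) := hκ (measurableSet_singleton j)
    have h2 : MeasurableSet {x | j ≤ κ x + 1} := hκ (measurableSet_le (α := ℕ)
      measurable_const (measurable_id.add_const 1))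
    rw [Measure.map_apply hh ((hf hA).inter h1), Measure.map_apply hh (hA.inter h2)]
    have := hν.measure_inter j (h ⁻¹' A) (hh hA)
    have e1 : h ⁻¹' (f ⁻¹' A ∩ κ ⁻¹' {j}) = g ⁻¹' (h ⁻¹' A) ∩ η ⁻¹' {j} := by
      ext y
      simp [hlevel, hmap]
    have e2 : h ⁻¹' (A ∩ {x | j ≤ κ x + 1}) = h ⁻¹' A ∩ {y | j ≤ η y + 1} := by
      ext y
      simp [hlevel]
    rw [e1, e2, this]

theorem measurableSet_level (hm : IsMarkov f κ ω m) (s : Set ℕ) : MeasurableSet (κ ⁻¹' s) :=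
  hm.measurable_level (MeasurableSet.of_discrete)

/-- Null sets are reflected because level `0` covers the whole space. -/
theorem isNonSingular (hm : IsMarkov f κ ω m) (hω : ∀ j, 0 < ω j) : Dyn.IsNonSingular f m := by
  intro A hA
  constructor
  · intro h
    have : f ⁻¹' A = ⋃ j, f ⁻¹' A ∩ κ ⁻¹' {j} := by
      ext x; simp
    rw [this, measure_iUnion_null_iff]
    intro j
    rw [hm.measure_inter j A hA, measure_mono_null Set.inter_subset_left h, mul_zero]
  · intro h
    have h0 := hm.measure_inter 0 A hA
    rw [measure_mono_null Set.inter_subset_left h, eq_comm, mul_eq_zero,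
      ENNReal.ofReal_eq_zero] at h0
    simpa using h0.resolve_left (not_le.2 (hω 0))

theorem measure_preimage_iterate (hm : IsMarkov f κ ω m) (hω : ∀ j, 0 < ω j) (i k : ℕ)
    {A : Set X} (hA : MeasurableSet A) (hAk : A ⊆ κ ⁻¹' {k}) :
    m (f^[i] ⁻¹' A) = ENNReal.ofReal (density ω i k) * m A := by
  induction i generalizing A k with
  | zero => simp
  | succ i ih =>
    have hfA : MeasurableSet (f ⁻¹' A) := hm.measurable_map hA
    have hpiece : ∀ j, MeasurableSet (f ⁻¹' A ∩ κ ⁻¹' {j}) := fun j =>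
      hfA.inter (hm.measurableSet_level {j})
    have hmass : ∀ j, m (f^[i] ⁻¹' (f ⁻¹' A ∩ κ ⁻¹' {j}))
        = if j ∈ Finset.range (k + 2) then
            ENNReal.ofReal (ω j * density ω i j) * m A else 0 := by
      intro j
      rw [ih j (hpiece j) Set.inter_subset_right, hm.measure_inter j A hA]
      split_ifs with h
      · have : A ∩ {x | j ≤ κ x + 1} = A := by
          refine Set.inter_eq_left.2 fun x hx => ?_
          have : κ x = k := hAk hx
          simp at h ⊢
          omega
        rw [this, ENNReal.ofReal_mul (hω j).le, ← mul_assoc, mul_comm (ENNReal.ofReal (ω j))]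
      · have : A ∩ {x | j ≤ κ x + 1} = ∅ := by
          refine Set.eq_empty_of_forall_notMem fun x hx => ?_
          have h1 : κ x = k := hAk hx.1
          have h2 : j ≤ κ x + 1 := hx.2
          simp at h
          omega
        simp [this]
    have hcover : f^[i + 1] ⁻¹' A = ⋃ j, f^[i] ⁻¹' (f ⁻¹' A ∩ κ ⁻¹' {j}) := by
      ext x
      have : f (f^[i] x) = f^[i] (f x) := (Function.Commute.refl f).iterate_right i x
      simp [this]
    rw [hcover, measure_iUnion]
    · simp_rw [hmass]
      rw [tsum_eq_sum (s := Finset.range (k + 2)) fun j hj => if_neg hj, density_succ, transfer,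
        ENNReal.ofReal_sum_of_nonneg fun j _ => mul_nonneg (hω j).le (density_nonneg hω i j),
        Finset.sum_mul]
      exact Finset.sum_congr rfl fun j hj => if_pos hj
    · intro j j' hjj'
      refine Disjoint.preimage _ (Set.disjoint_left.2 fun x hx hx' => hjj' ?_)
      exact hx.2.symm.trans hx'.2
    · exact fun j => (hm.measurable_map.iterate i) (hpiece j)

/-- The preimages of a wandering set are disjoint, so their masses have a finite sum. -/
theorem isConservative [IsProbabilityMeasure m] (hm : IsMarkov f κ ω m) (hω : ∀ j, 0 < ω j)
    (hdiv : ∀ k, ¬ Summable fun i => density ω i k) : Dyn.IsConservative f m := by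
  refine ⟨hm.isNonSingular hω, fun V hV => ?_⟩
  have hcover : V = ⋃ k, V ∩ κ ⁻¹' {k} := by
    ext x; simp
  rw [hcover, measure_iUnion_null_iff]
  intro k
  by_contra hne
  have hVk : MeasurableSet (V ∩ κ ⁻¹' {k}) := hV.1.inter (hm.measurableSet_level {k})
  have hsum : ∑' i, m (f^[i] ⁻¹' (V ∩ κ ⁻¹' {k})) ≤ 1 := by
    refine (tsum_meas_le_meas_iUnion_of_disjoint m
      (fun i => (hm.measurable_map.iterate i) hVk) fun i j hij => ?_).trans prob_le_one
    exact (hV.2 hij).mono (Set.preimage_mono Set.inter_subset_left)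
      (Set.preimage_mono Set.inter_subset_left)
  simp_rw [hm.measure_preimage_iterate hω _ k hVk Set.inter_subset_right] at hsum
  rw [ENNReal.tsum_mul_right] at hsum
  have hfin : ∑' i, ENNReal.ofReal (density ω i k) ≠ ⊤ := by
    intro htop
    rw [htop, ENNReal.top_mul hne] at hsum
    simp at hsum
  refine hdiv k ?_
  have := ENNReal.summable_toReal hfin
  simpa only [ENNReal.toReal_ofReal (density_nonneg hω _ k)] using this

/-- By Borel–Cantelli almost every orbit has a last visit to its initial level, so almost every point
lies in a preimage of the set of points that never return to their level. -/
theorem isDissipative [IsProbabilityMeasure m] (hm : IsMarkov f κ ω m) (hω : ∀ j, 0 < ω j)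
    (hconv : ∀ k, Summable fun i => density ω i k) : Dyn.IsDissipative f m := by
  refine ⟨hm.isNonSingular hω, ?_⟩
  -- the points of level `k` that never return to it
  let V : ℕ → Set X := fun k => κ ⁻¹' {k} ∩ ⋂ i, (f^[i + 1] ⁻¹' (κ ⁻¹' {k}))ᶜ
  have hlev : ∀ k, MeasurableSet (κ ⁻¹' {k}) := fun k => hm.measurableSet_level {k}
  have hV : ∀ k, MeasurableSet (V k) := fun k =>
    (hlev k).inter (MeasurableSet.iInter fun i =>
      ((hm.measurable_map.iterate (i + 1)) (hlev k)).compl)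
  have hwander : ∀ k n, Dyn.IsWandering f (f^[n] ⁻¹' V k) := by
    intro k n
    refine ⟨(hm.measurable_map.iterate n) (hV k), ?_⟩
    have aux : ∀ i d, Disjoint (f^[i] ⁻¹' (f^[n] ⁻¹' V k))
        (f^[i + (d + 1)] ⁻¹' (f^[n] ⁻¹' V k)) := by
      intro i d
      refine Set.disjoint_left.2 fun x hx hx' => ?_
      have h1 := Set.mem_iInter.1 hx.2 d
      apply h1
      have h2 := hx'.1
      simp only [Set.mem_preimage, ← Function.iterate_add_apply] at h2 ⊢
      rwa [show d + 1 + (n + i) = n + (i + (d + 1)) by ring]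
    intro i j hij
    rcases lt_or_gt_of_ne hij with h | h
    · obtain ⟨d, rfl⟩ := Nat.exists_eq_add_of_lt h
      exact aux i d
    · obtain ⟨d, rfl⟩ := Nat.exists_eq_add_of_lt h
      exact (aux j d).symm
  have hfin : ∀ᵐ x ∂m, ∀ k, ∀ᶠ i in atTop, κ (f^[i] x) ≠ k := by
    refine ae_all_iff.2 fun k => ?_
    refine ae_eventually_notMem (s := fun i => f^[i] ⁻¹' (κ ⁻¹' {k})) ?_
    simp_rw [hm.measure_preimage_iterate hω _ k (hlev k) subset_rfl]
    rw [ENNReal.tsum_mul_right]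
    refine ENNReal.mul_ne_top ?_ (measure_ne_top m _)
    rw [← ENNReal.ofReal_tsum_of_nonneg (fun i => density_nonneg hω i k) (hconv k)]
    exact ENNReal.ofReal_ne_top
  refine ⟨fun q => f^[q.unpair.2] ⁻¹' V q.unpair.1, fun q => hwander _ _, ?_⟩
  refine measure_mono_null ?_ (ae_iff.1 hfin)
  intro x hx hx'
  refine hx ?_
  -- the last visit of the orbit to its initial level
  obtain ⟨N, hN⟩ := eventually_atTop.1 (hx' (κ x))
  have hP : ∃ n, ∀ i, n < i → κ (f^[i] x) ≠ κ x := ⟨N, fun i hi => hN i hi.le⟩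
  classical
  have hspec := Nat.find_spec hP
  have hvisit : κ (f^[Nat.find hP] x) = κ x := by
    rcases hn : Nat.find hP with _ | n
    · rfl
    · by_contra hne
      refine Nat.find_min hP (m := n) (by omega) fun i hi => ?_
      rcases (Nat.succ_le_of_lt hi).eq_or_lt with h | h
      · rw [← h]; exact hne
      · exact hspec i (by omega)
  refine Set.mem_iUnion.2 ⟨Nat.pair (κ x) (Nat.find hP), ?_⟩
  simp only [Nat.unpair_pair]
  refine ⟨hvisit, Set.mem_iInter.2 fun i hi => ?_⟩
  refine hspec (i + 1 + Nat.find hP) (by omega) ?_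
  rw [Function.iterate_add_apply]
  exact hi

theorem tail_sub [IsProbabilityMeasure m] (hm : IsMarkov f κ ω m) (hω : ∀ j, 0 < ω j) (j : ℕ) :
    m.real {x | j ≤ κ x} - m.real {x | j + 1 ≤ κ x} = ω j * m.real {x | j - 1 ≤ κ x} := by
  have h1 : MeasurableSet {x | j + 1 ≤ κ x} := hm.measurableSet_level {n | j + 1 ≤ n}
  have h2 : {x | j + 1 ≤ κ x} ⊆ {x | j ≤ κ x} := fun x (hx : j + 1 ≤ κ x) =>
    show j ≤ κ x by omega
  rw [← measureReal_sdiff h2 h1]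
  have h3 : {x | j ≤ κ x} \ {x | j + 1 ≤ κ x} = f ⁻¹' Set.univ ∩ κ ⁻¹' {j} := by
    ext x
    simp
    omega
  have h4 : {x | j - 1 ≤ κ x} = Set.univ ∩ {x | j ≤ κ x + 1} := by
    ext x
    simp
  rw [h3, h4, measureReal_def, hm.measure_inter j _ MeasurableSet.univ, ENNReal.toReal_mul,
    ENNReal.toReal_ofReal (hω j).le, measureReal_def]

theorem tail_pos [IsProbabilityMeasure m] (hm : IsMarkov f κ ω m) (hω : ∀ j, 0 < ω j) (j : ℕ) :
    0 < m.real {x | j ≤ κ x} := by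
  induction j with
  | zero => simp
  | succ j ih =>
    have h1 := hm.tail_sub hω (j + 1)
    have h2 := mul_pos (hω (j + 1)) ih
    have h3 : 0 ≤ m.real {x | j + 1 + 1 ≤ κ x} := measureReal_nonneg
    rw [Nat.add_sub_cancel] at h1
    linarith

theorem weight_le [IsProbabilityMeasure m] {a u : ℝ} (ha : 0 < a) (hu : 0 < u)
    (hm : IsMarkov f κ (weight a (a * u)) m) : a * u ≤ 1 / 4 ∧ (u ≤ 1 / 2 → a ≤ 1 - u) :=
  weight_le_of_tail (s := fun j => m.real {x | j ≤ κ x}) ha hu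
    (hm.tail_pos (weight_pos ha (mul_pos ha hu))) (by simp)
    (hm.tail_sub (weight_pos ha (mul_pos ha hu)))

end IsMarkov

end Markov

open PLMap

/-! ### Cascades: piecewise affine models -/

/-- The sequence `s` decreases from `1` to `0` in such a way that, for each `j`, the affine map with
slope `1 / ω j` takes `(s (j + 1), s j]` onto `(0, s (j - 1)]`, where `s (0 - 1) = s 0 = 1` by
truncated subtraction. -/
structure IsCascade (s ω : ℕ → ℝ) : Prop where
  weight_pos : ∀ j, 0 < ω j
  pos : ∀ j, 0 < s j
  zero : s 0 = 1
  sub : ∀ j, s j - s (j + 1) = ω j * s (j - 1)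
  tendsto : Tendsto s atTop (𝓝 0)

namespace IsCascade

variable {s ω s' ω' : ℕ → ℝ}

theorem succ_lt (hs : IsCascade s ω) (j : ℕ) : s (j + 1) < s j := by
  have := mul_pos (hs.weight_pos j) (hs.pos (j - 1))
  linarith [hs.sub j]

theorem strictAnti (hs : IsCascade s ω) : StrictAnti s := strictAnti_nat_of_succ_lt hs.succ_lt

theorem exists_lt (hs : IsCascade s ω) (x : X) : ∃ j, s (j + 1) < x :=
  ((hs.tendsto.comp (tendsto_add_atTop_nat 1)).eventually_lt_const x.2.1).exists

open Classical in
/-- The index `j` of the interval `(s (j + 1), s j]` that contains `x`. -/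
noncomputable def level (hs : IsCascade s ω) (x : X) : ℕ := Nat.find (hs.exists_lt x)

theorem level_mem (hs : IsCascade s ω) (x : X) :
    (x : ℝ) ∈ Set.Ioc (s (hs.level x + 1)) (s (hs.level x)) := by
  classical
  refine ⟨Nat.find_spec (hs.exists_lt x), ?_⟩
  rcases hk : hs.level x with _ | k
  · rw [hs.zero]
    exact x.2.2
  · exact not_lt.1 (Nat.find_min (hs.exists_lt x) (m := k) (by unfold level at hk; omega))

theorem level_eq_iff (hs : IsCascade s ω) {x : X} {j : ℕ} :
    hs.level x = j ↔ (x : ℝ) ∈ Set.Ioc (s (j + 1)) (s j) := by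
  constructor
  · rintro rfl
    exact hs.level_mem x
  · intro h
    have h1 := hs.level_mem x
    have h2 := hs.strictAnti.lt_iff_gt.1 (h.1.trans_le h1.2)
    have h3 := hs.strictAnti.lt_iff_gt.1 (h1.1.trans_le h.2)
    omega

theorem measurable_level (hs : IsCascade s ω) : Measurable hs.level := by
  refine measurable_to_countable' fun j => ?_
  have : hs.level ⁻¹' {j} = Subtype.val ⁻¹' Set.Ioc (s (j + 1)) (s j) := by
    ext x
    exact hs.level_eq_iff
  rw [this]
  exact measurable_subtype_coe measurableSet_Ioc

theorem map_aux (hs : IsCascade s ω) (x : X) :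
    0 < (x - s (hs.level x + 1)) / ω (hs.level x) ∧
      (x - s (hs.level x + 1)) / ω (hs.level x) ≤ s (hs.level x - 1) := by
  have hx := hs.level_mem x
  have hω := hs.weight_pos (hs.level x)
  refine ⟨div_pos (sub_pos.2 hx.1) hω, ?_⟩
  rw [div_le_iff₀ hω]
  linarith [hs.sub (hs.level x), hx.2]

theorem le_one (hs : IsCascade s ω) (j : ℕ) : s j ≤ 1 :=
  hs.zero ▸ hs.strictAnti.antitone (Nat.zero_le j)

/-- The map that is affine from each interval `(s (j + 1), s j]` onto `(0, s (j - 1)]`. -/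
noncomputable def map (hs : IsCascade s ω) (x : X) : X :=
  ⟨(x - s (hs.level x + 1)) / ω (hs.level x), (hs.map_aux x).1,
    (hs.map_aux x).2.trans (hs.le_one _)⟩

theorem coe_map (hs : IsCascade s ω) (x : X) :
    (hs.map x : ℝ) = (x - s (hs.level x + 1)) / ω (hs.level x) := rfl

theorem coe_eq (hs : IsCascade s ω) (x : X) :
    (x : ℝ) = s (hs.level x + 1) + ω (hs.level x) * hs.map x := by
  rw [coe_map, mul_div_cancel₀ _ (hs.weight_pos _).ne']
  ring

theorem coe_le_iff (hs : IsCascade s ω) {x : X} {j : ℕ} : (x : ℝ) ≤ s j ↔ j ≤ hs.level x := by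
  have h := hs.level_mem x
  constructor
  · intro hx
    have := hs.strictAnti.lt_iff_gt.1 (h.1.trans_le hx)
    omega
  · intro hj
    exact h.2.trans (hs.strictAnti.antitone hj)

theorem level_le (hs : IsCascade s ω) (x : X) : hs.level x ≤ hs.level (hs.map x) + 1 := by
  have : hs.level x - 1 ≤ hs.level (hs.map x) := hs.coe_le_iff.1 (hs.map_aux x).2
  omega

theorem measurable_map (hs : IsCascade s ω) : Measurable hs.map := by
  have hs' : Measurable s := measurable_from_nat
  have hω' : Measurable ω := measurable_from_nat
  have hl := hs.measurable_level
  exact Measurable.subtype_mk (by fun_prop)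

theorem injOn_map (hs : IsCascade s ω) (j : ℕ) : Set.InjOn hs.map (hs.level ⁻¹' {j}) := by
  intro x hx y hy h
  have hx' : hs.level x = j := hx
  have hy' : hs.level y = j := hy
  ext
  rw [hs.coe_eq x, hs.coe_eq y, h, hx', hy']

theorem branch_mem (hs : IsCascade s ω) {j : ℕ} {z : X} (hj : j ≤ hs.level z + 1) :
    s (j + 1) + ω j * z ∈ Set.Ioc (s (j + 1)) (s j) := by
  have hω := hs.weight_pos j
  refine ⟨lt_add_of_pos_right _ (mul_pos hω z.2.1), ?_⟩
  have hz : (z : ℝ) ≤ s (j - 1) := hs.coe_le_iff.2 (by omega)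
  linarith [hs.sub j, mul_le_mul_of_nonneg_left hz hω.le]

theorem map_eq_of_coe_eq (hs : IsCascade s ω) {j : ℕ} {x z : X}
    (hx : hs.level x = j) (h : (x : ℝ) = s (j + 1) + ω j * z) : hs.map x = z := by
  subst hx
  ext
  rw [coe_map, h, add_sub_cancel_left, mul_div_cancel_left₀ _ (hs.weight_pos _).ne']

/-- Every point of level at least `j - 1` has a preimage of level `j`. -/
theorem exists_preimage (hs : IsCascade s ω) {j : ℕ} {z : X} (hj : j ≤ hs.level z + 1) :
    ∃ x, hs.level x = j ∧ hs.map x = z := by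
  have h := hs.branch_mem hj
  let x : X := ⟨s (j + 1) + ω j * z, (hs.pos _).trans h.1, h.2.trans (hs.le_one j)⟩
  have hx : hs.level x = j := hs.level_eq_iff.2 h
  exact ⟨x, hx, hs.map_eq_of_coe_eq hx rfl⟩

theorem isMarkov_volume (hs : IsCascade s ω) :
    IsMarkov hs.map hs.level ω (volume.comap (Subtype.val : X → ℝ)) where
  measurable_map := hs.measurable_map
  measurable_level := hs.measurable_level
  measure_inter j A hA := by
    have hω := hs.weight_pos j
    rw [comap_subtype_coe_apply measurableSet_Ioc, comap_subtype_coe_apply measurableSet_Ioc]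
    have himage : (Subtype.val '' (hs.map ⁻¹' A ∩ hs.level ⁻¹' {j}) : Set ℝ)
        = (fun y => y + -s (j + 1)) ⁻¹' (((ω j)⁻¹ * ·) ⁻¹'
          (Subtype.val '' (A ∩ {z | j ≤ hs.level z + 1}))) := by
      ext y
      constructor
      · rintro ⟨x, ⟨hxA, hxj⟩, rfl⟩
        have hxj' : hs.level x = j := hxj
        refine ⟨hs.map x, ⟨hxA, ?_⟩, ?_⟩
        · exact hxj' ▸ hs.level_le x
        · rw [coe_map, hxj', div_eq_inv_mul, sub_eq_add_neg]
      · rintro ⟨z, ⟨hzA, hzj⟩, hz⟩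
        obtain ⟨x, hxj, hxz⟩ := hs.exists_preimage hzj
        refine ⟨x, ⟨?_, hxj⟩, ?_⟩
        · rw [Set.mem_preimage, hxz]
          exact hzA
        · rw [hs.coe_eq x, hxj, hxz, hz]
          field_simp
          ring
    rw [himage, measure_preimage_add_right, Real.volume_preimage_mul_left (inv_pos.2 hω).ne',
      inv_inv, abs_of_pos hω]

/-- The approximations, from below, of the semiconjugacy to the cascade with parameters `s'`, `ω'`:
the point of level `hs.level y` whose image is the preceding approximation at `hs.map y`. -/
noncomputable def approx (hs : IsCascade s ω) (s' ω' : ℕ → ℝ) : ℕ → X → ℝ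
  | 0 => fun _ => 0
  | K + 1 => fun y =>
      s' (hs.level y + 1) + ω' (hs.level y) * approx hs s' ω' K (hs.map y)

theorem measurable_approx (hs : IsCascade s ω) (s' ω' : ℕ → ℝ) (K : ℕ) :
    Measurable (hs.approx s' ω' K) := by
  induction K with
  | zero => exact measurable_const
  | succ K ih =>
    have h1 : Measurable s' := measurable_from_nat
    have h2 : Measurable ω' := measurable_from_nat
    have h3 := hs.measurable_level
    have h4 := hs.measurable_map
    unfold approx
    fun_prop

theorem approx_le (hs : IsCascade s ω) (hs' : IsCascade s' ω') (K : ℕ) (y : X) :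
    hs.approx s' ω' K y ≤ s' (hs.level y) := by
  induction K generalizing y with
  | zero => exact (hs'.pos _).le
  | succ K ih =>
    have h1 : s' (hs.level (hs.map y)) ≤ s' (hs.level y - 1) :=
      hs'.strictAnti.antitone (by have := hs.level_le y; omega)
    have h2 := mul_le_mul_of_nonneg_left ((ih (hs.map y)).trans h1)
      (hs'.weight_pos (hs.level y)).le
    unfold approx
    linarith [hs'.sub (hs.level y)]

theorem approx_mono (hs : IsCascade s ω) (hs' : IsCascade s' ω') (y : X) :
    Monotone fun K => hs.approx s' ω' K y := by
  refine monotone_nat_of_le_succ fun K => ?_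
  induction K generalizing y with
  | zero =>
    have h1 := hs'.pos (hs.level y + 1)
    simp only [approx]
    linarith
  | succ K ih =>
    have := mul_le_mul_of_nonneg_left (ih (hs.map y)) (hs'.weight_pos (hs.level y)).le
    rw [approx, approx]
    linarith

theorem exists_semiconj (hs : IsCascade s ω) (hs' : IsCascade s' ω') :
    ∃ h : X → X, Measurable h ∧ (∀ y, hs'.level (h y) = hs.level y) ∧
      ∀ y, hs'.map (h y) = h (hs.map y) := by
  have hbdd : ∀ y, BddAbove (Set.range fun K => hs.approx s' ω' K y) := fun y =>
    ⟨_, by rintro _ ⟨K, rfl⟩; exact hs.approx_le hs' K y⟩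
  set H : X → ℝ := fun y => ⨆ K, hs.approx s' ω' K y
  have hlim : ∀ y, Tendsto (fun K => hs.approx s' ω' K y) atTop (𝓝 (H y)) := fun y =>
    tendsto_atTop_ciSup (hs.approx_mono hs' y) (hbdd y)
  have hmeas : Measurable H := measurable_of_tendsto_metrizable
    (fun K => hs.measurable_approx s' ω' K) (tendsto_pi_nhds.2 hlim)
  have heq : ∀ y, H y = s' (hs.level y + 1) + ω' (hs.level y) * H (hs.map y) := fun y =>
    tendsto_nhds_unique ((hlim y).comp (tendsto_add_atTop_nat 1))
      (((hlim (hs.map y)).const_mul _).const_add _)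
  have hnonneg : ∀ y, 0 ≤ H y := fun y => le_ciSup (hbdd y) 0
  have hpos : ∀ y, 0 < H y := by
    intro y
    rw [heq]
    exact add_pos_of_pos_of_nonneg (hs'.pos _) (mul_nonneg (hs'.weight_pos _).le (hnonneg _))
  have hle : ∀ y, H y ≤ s' (hs.level y) := fun y => ciSup_le fun K => hs.approx_le hs' K y
  let h : X → X := fun y => ⟨H y, hpos y, (hle y).trans (hs'.le_one _)⟩
  have hlevel : ∀ y, hs'.level (h y) = hs.level y := by
    refine fun y => hs'.level_eq_iff.2 ⟨?_, hle y⟩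
    change _ < H y
    rw [heq]
    exact lt_add_of_pos_right _ (mul_pos (hs'.weight_pos _) (hpos _))
  exact ⟨h, hmeas.subtype_mk, hlevel, fun y => hs'.map_eq_of_coe_eq (hlevel y) (heq y)⟩

theorem exists_isMarkov (hs : IsCascade s ω) (hs' : IsCascade s' ω') :
    ∃ m : Measure X, IsProbabilityMeasure m ∧ IsMarkov hs'.map hs'.level ω m := by
  obtain ⟨h, hh, hlevel, hmap⟩ := hs.exists_semiconj hs'
  have hvol : IsProbabilityMeasure (volume.comap (Subtype.val : X → ℝ)) := ⟨by
    rw [comap_subtype_coe_apply measurableSet_Ioc, Set.image_univ, Subtype.range_coe,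
      Real.volume_Ioc]
    simp⟩
  exact ⟨Measure.map h _, Measure.isProbabilityMeasure_map hh.aemeasurable,
    hs.isMarkov_volume.map hs'.measurable_map hs'.measurable_level hh hlevel hmap⟩

end IsCascade

/-- For `u = lam` this is the cascade of `F lam`. -/
theorem isCascade_pow {u : ℝ} (hu : u ∈ Set.Ioo (0 : ℝ) 1) :
    IsCascade (fun j => u ^ j) (weight (1 - u) (u * (1 - u))) where
  weight_pos := weight_pos (sub_pos.2 hu.2) (mul_pos hu.1 (sub_pos.2 hu.2))
  pos j := pow_pos hu.1 j
  zero := pow_zero u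
  sub j := by
    cases j with
    | zero => simp
    | succ j =>
      simp only [weight_succ, Nat.add_sub_cancel]
      ring
  tendsto := tendsto_pow_atTop_nhds_zero_of_lt_one hu.1.le hu.2

/-- For `b = 1 / 4` the characteristic polynomial `x ^ 2 - x + b` has the double root `1 / 2`. -/
theorem isCascade_linear_div_two_pow {a : ℝ} (ha : 0 < a) (ha2 : a ≤ 1 / 2) :
    IsCascade (fun j => (1 + (1 - 2 * a) * j) / 2 ^ j) (weight a (1 / 4)) where
  weight_pos := weight_pos ha (by norm_num)
  pos j := by
    have : 0 ≤ (1 - 2 * a) * j := mul_nonneg (by linarith) (Nat.cast_nonneg j)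
    positivity
  zero := by simp
  sub j := by
    cases j with
    | zero =>
      simp
      ring
    | succ j =>
      simp only [weight_succ, Nat.add_sub_cancel]
      push_cast
      field_simp
      ring
  tendsto := by
    have h1 := tendsto_pow_const_div_const_pow_of_one_lt 0 (one_lt_two : (1 : ℝ) < 2)
    have h2 := tendsto_pow_const_div_const_pow_of_one_lt 1 (one_lt_two : (1 : ℝ) < 2)
    have h3 := h1.add (h2.const_mul (1 - 2 * a))
    simp only [mul_zero, add_zero] at h3
    refine h3.congr fun j => ?_
    ring

/-! ### The map `F` and its conformal measures -/

theorem idx_eq {lam : ℝ} (hl : lam ∈ Set.Ioo (0 : ℝ) 1) {x : ℝ} {j : ℕ}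
    (hx : x ∈ Set.Ioc (lam ^ (j + 1)) (lam ^ j)) : idx lam x = j + 1 := by
  have hx01 : x ∈ Set.Ioc (0 : ℝ) 1 :=
    ⟨(pow_pos hl.1 _).trans hx.1, hx.2.trans (pow_le_one₀ hl.1.le hl.2.le)⟩
  obtain ⟨h1, h2, h3⟩ := idx_spec hl hx01
  have h4 := (pow_lt_pow_iff_right_of_lt_one₀ hl.1 hl.2).1 (h2.trans_le hx.2)
  have h5 := (pow_lt_pow_iff_right_of_lt_one₀ hl.1 hl.2).1 (hx.1.trans_le h3)
  omega

theorem mapReal_eq {lam : ℝ} (hl : lam ∈ Set.Ioo (0 : ℝ) 1) {x : ℝ} {j : ℕ}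
    (hx : x ∈ Set.Ioc (lam ^ (j + 1)) (lam ^ j)) :
    mapReal lam x = (x - lam ^ (j + 1)) / weight (1 - lam) (lam * (1 - lam)) j := by
  rw [mapReal, idx_eq hl hx]
  cases j <;> simp

theorem F_eq_map {lam : ℝ} (hl : lam ∈ Set.Ioo (0 : ℝ) 1) : F lam hl = (isCascade_pow hl).map := by
  funext x
  ext
  rw [IsCascade.coe_map]
  exact mapReal_eq hl ((isCascade_pow hl).level_mem x)

theorem Phi_eq {lam : ℝ} (hl : lam ∈ Set.Ioo (0 : ℝ) 1) (t : ℝ) (x : X) :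
    Phi lam t x
      = t * Real.log (weight (1 - lam) (lam * (1 - lam)) ((isCascade_pow hl).level x)) := by
  set j := (isCascade_pow hl).level x
  have hx : (x : ℝ) ∈ Set.Ioc (lam ^ (j + 1)) (lam ^ j) := (isCascade_pow hl).level_mem x
  have hω := (isCascade_pow hl).weight_pos j
  set c := weight (1 - lam) (lam * (1 - lam)) j
  have hev : mapReal lam =ᶠ[𝓝[Set.Iic (x : ℝ)] (x : ℝ)] fun y => (y - lam ^ (j + 1)) / c := by
    filter_upwards [self_mem_nhdsWithin, mem_nhdsWithin_of_mem_nhds (Ioi_mem_nhds hx.1)]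
      with y hy1 hy2
    exact mapReal_eq hl ⟨hy2, le_trans hy1 hx.2⟩
  have hder : HasDerivWithinAt (fun y : ℝ => (y - lam ^ (j + 1)) / c) (1 / c)
      (Set.Iic (x : ℝ)) x := (((hasDerivAt_id (x : ℝ)).sub_const _).div_const c).hasDerivWithinAt
  have hd := (hder.congr_of_eventuallyEq hev (mapReal_eq hl hx)).derivWithin
    (uniqueDiffWithinAt_Iic _)
  rw [Phi, hd, one_div, abs_of_pos (inv_pos.2 hω), Real.log_inv]
  ring

/-- The Jacobian of a `(t, p)`-conformal measure depends only on the level. -/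
theorem exp_neg_Phi {lam : ℝ} (hl : lam ∈ Set.Ioo (0 : ℝ) 1) (t p : ℝ) (x : X) :
    Real.exp (-(Phi lam t x - p)) = (weight (Real.exp (-p) * (1 - lam) ^ t)
      (Real.exp (-p) * (1 - lam) ^ t * lam ^ t) ((isCascade_pow hl).level x))⁻¹ := by
  have h1 : 0 < 1 - lam := sub_pos.2 hl.2
  rw [Phi_eq hl]
  cases (isCascade_pow hl).level x with
  | zero =>
    rw [weight_zero, weight_zero, Real.rpow_def_of_pos h1, ← Real.exp_add, ← Real.exp_neg]
    congr 1
    ring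
  | succ j =>
    rw [weight_succ, weight_succ, Real.rpow_def_of_pos h1, Real.rpow_def_of_pos hl.1,
      ← Real.exp_add, ← Real.exp_add, ← Real.exp_neg, Real.log_mul hl.1.ne' h1.ne']
    congr 1
    ring

/-- A conformal measure whose Jacobian is constant on each level is a Markov measure. A set on which
the map is one-to-one is cut into its pieces of constant level; their images are disjoint, and are
measurable by the Lusin–Souslin theorem. -/
theorem isConformal_iff_isMarkov {s ω ω' : ℕ → ℝ} (hs : IsCascade s ω) (hω' : ∀ j, 0 < ω' j)
    {φ : X → ℝ} (hφ : ∀ x, Real.exp (-(φ x)) = (ω' (hs.level x))⁻¹) (m : Measure X) :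
    Dyn.IsConformal hs.map φ m ↔
      IsProbabilityMeasure m ∧ IsMarkov hs.map hs.level ω' m := by
  have hlev : ∀ j, MeasurableSet (hs.level ⁻¹' {j}) := fun j =>
    hs.measurable_level (measurableSet_singleton j)
  have hpiece : ∀ (j : ℕ) (A : Set X), MeasurableSet A →
      ∫⁻ x in A ∩ hs.level ⁻¹' {j}, ENNReal.ofReal (Real.exp (-(φ x))) ∂m
        = (ENNReal.ofReal (ω' j))⁻¹ * m (A ∩ hs.level ⁻¹' {j}) := by
    intro j A hA
    rw [← ENNReal.ofReal_inv_of_pos (hω' j), ← setLIntegral_const]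
    refine setLIntegral_congr_fun (hA.inter (hlev j)) fun x hx => ?_
    have hxj : hs.level x = j := hx.2
    simp only [hφ, hxj]
  have h0 : ∀ j, ENNReal.ofReal (ω' j) ≠ 0 := fun j => by simpa using hω' j
  constructor
  · intro h
    refine ⟨h.isProbabilityMeasure, hs.measurable_map, hs.measurable_level, fun j A hA => ?_⟩
    have hpre : MeasurableSet (hs.map ⁻¹' A) := hs.measurable_map hA
    have hinj : Set.InjOn hs.map (hs.map ⁻¹' A ∩ hs.level ⁻¹' {j}) :=
      (hs.injOn_map j).mono Set.inter_subset_right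
    have himage : hs.map '' (hs.map ⁻¹' A ∩ hs.level ⁻¹' {j})
        = A ∩ {x | j ≤ hs.level x + 1} := by
      ext z
      constructor
      · rintro ⟨x, ⟨hxA, rfl⟩, rfl⟩
        exact ⟨hxA, hs.level_le x⟩
      · rintro ⟨hzA, hzj⟩
        obtain ⟨x, hxj, rfl⟩ := hs.exists_preimage hzj
        exact ⟨x, ⟨hzA, hxj⟩, rfl⟩
    rw [← himage, h.measure_image _ (hpre.inter (hlev j)) hinj, hpiece j _ hpre, ← mul_assoc,
      ENNReal.mul_inv_cancel (h0 j) ENNReal.ofReal_ne_top, one_mul]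
  · rintro ⟨hprob, hm⟩
    refine ⟨hprob, fun A hA hinj => ?_⟩
    have : StandardBorelSpace X := measurableSet_Ioc.standardBorel
    have hAj : ∀ j, MeasurableSet (A ∩ hs.level ⁻¹' {j}) := fun j => hA.inter (hlev j)
    have himeas : ∀ j, MeasurableSet (hs.map '' (A ∩ hs.level ⁻¹' {j})) := fun j =>
      (hAj j).image_of_measurable_injOn hs.measurable_map (hinj.mono Set.inter_subset_left)
    have hcover : A = ⋃ j, A ∩ hs.level ⁻¹' {j} := by
      ext x; simp
    have hdisj : Pairwise (Function.onFun Disjoint fun j => A ∩ hs.level ⁻¹' {j}) := by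
      intro j j' hne
      exact Set.disjoint_left.2 fun x hx hx' => hne (hx.2.symm.trans hx'.2)
    have hdisj' : Pairwise (Function.onFun Disjoint fun j => hs.map '' (A ∩ hs.level ⁻¹' {j})) := by
      intro j j' hne
      refine Set.disjoint_left.2 ?_
      rintro _ ⟨x, hx, rfl⟩ ⟨x', hx', hxx'⟩
      obtain rfl := hinj hx'.1 hx.1 hxx'
      exact hne (hx.2.symm.trans hx'.2)
    have hbranch : ∀ j, m (hs.map '' (A ∩ hs.level ⁻¹' {j}))
        = (ENNReal.ofReal (ω' j))⁻¹ * m (A ∩ hs.level ⁻¹' {j}) := by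
      intro j
      have h1 := hm.measure_inter j _ (himeas j)
      have h2 : hs.map ⁻¹' (hs.map '' (A ∩ hs.level ⁻¹' {j})) ∩ hs.level ⁻¹' {j}
          = A ∩ hs.level ⁻¹' {j} := by
        ext x
        constructor
        · rintro ⟨⟨x', hx', hxx'⟩, hx⟩
          obtain rfl := hs.injOn_map j hx'.2 hx hxx'
          exact hx'
        · exact fun hx => ⟨⟨x, hx, rfl⟩, hx.2⟩
      have h3 : hs.map '' (A ∩ hs.level ⁻¹' {j}) ∩ {x | j ≤ hs.level x + 1}
          = hs.map '' (A ∩ hs.level ⁻¹' {j}) := by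
        refine Set.inter_eq_left.2 ?_
        rintro _ ⟨x, ⟨_, rfl⟩, rfl⟩
        exact hs.level_le x
      rw [h2, h3] at h1
      rw [h1, ← mul_assoc, ENNReal.inv_mul_cancel (h0 j) ENNReal.ofReal_ne_top, one_mul]
    conv_lhs => rw [hcover, Set.image_iUnion, measure_iUnion hdisj' himeas]
    conv_rhs => rw [hcover, lintegral_iUnion hAj hdisj]
    exact tsum_congr fun j => by rw [hbranch, hpiece j A hA]

theorem isTPConformal_iff {lam : ℝ} (hl : lam ∈ Set.Ioo (0 : ℝ) 1) (t p : ℝ) (m : Measure X) :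
    IsTPConformal lam hl t p m ↔ IsProbabilityMeasure m ∧
      IsMarkov (F lam hl) (isCascade_pow hl).level (weight (Real.exp (-p) * (1 - lam) ^ t)
        (Real.exp (-p) * (1 - lam) ^ t * lam ^ t)) m := by
  have ha : 0 < Real.exp (-p) * (1 - lam) ^ t :=
    mul_pos (Real.exp_pos _) (Real.rpow_pos_of_pos (sub_pos.2 hl.2) t)
  rw [IsTPConformal, F_eq_map hl]
  exact isConformal_iff_isMarkov (isCascade_pow hl)
    (weight_pos ha (mul_pos ha (Real.rpow_pos_of_pos hl.1 t))) (exp_neg_Phi hl t p) m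

/-! ### The critical weight and the pressure -/

/-- The largest weight `a` for which there is a Markov probability measure with weights
`a, a * u, a * u, …`. -/
noncomputable def criticalWeight (u : ℝ) : ℝ := if u ≤ 1 / 2 then 1 - u else 1 / (4 * u)

theorem criticalWeight_pos {u : ℝ} (hu : 0 < u) : 0 < criticalWeight u := by
  unfold criticalWeight
  split_ifs
  · linarith
  · positivity

theorem le_criticalWeight {u a : ℝ} (hu : 0 < u) (h1 : a * u ≤ 1 / 4) (h2 : u ≤ 1 / 2 → a ≤ 1 - u) :
    a ≤ criticalWeight u := by
  unfold criticalWeight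
  split_ifs with h
  · exact h2 h
  · rw [le_div_iff₀ (by positivity)]
    linarith

theorem exists_isCascade_criticalWeight {u : ℝ} (hu : 0 < u) :
    ∃ s, IsCascade s (weight (criticalWeight u) (criticalWeight u * u)) := by
  unfold criticalWeight
  split_ifs with h
  · exact ⟨_, by simpa only [mul_comm] using isCascade_pow (u := u) ⟨hu, by linarith⟩⟩
  · have e : 1 / (4 * u) * u = 1 / 4 := by field_simp
    rw [e]
    refine ⟨_, isCascade_linear_div_two_pow (by positivity) ?_⟩
    rw [div_le_div_iff₀ (by positivity) (by norm_num)]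
    linarith

theorem summable_density_of_le_criticalWeight {u a : ℝ} (ha : 0 < a) (hu : 0 < u)
    (h : a ≤ criticalWeight u) (hne : u ≤ 1 / 2 → a ≠ criticalWeight u) (k : ℕ) :
    Summable fun i => density (weight a (a * u)) i k := by
  by_cases hu2 : u ≤ 1 / 2
  · have h' := lt_of_le_of_ne h (hne hu2)
    rw [criticalWeight, if_pos hu2] at h'
    exact summable_density (x := 1 - u) ha (mul_pos ha hu) (by linarith) (by nlinarith) h' k
  · rw [criticalWeight, if_neg hu2, le_div_iff₀ (by positivity)] at h
    exact summable_density (x := 1 / 2) ha (mul_pos ha hu) (by norm_num) (by linarith)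
      (by nlinarith) k

/-- The value of `p` for which the weight `e ^ (-p) * (1 - lam) ^ t` of level `0` is critical. -/
noncomputable def pressure (lam t : ℝ) : ℝ :=
  Real.log ((1 - lam) ^ t / criticalWeight (lam ^ t))

theorem exp_neg_pressure {lam : ℝ} (hl : lam ∈ Set.Ioo (0 : ℝ) 1) (t : ℝ) :
    Real.exp (-pressure lam t) * (1 - lam) ^ t = criticalWeight (lam ^ t) := by
  have h1 : 0 < (1 - lam) ^ t := Real.rpow_pos_of_pos (sub_pos.2 hl.2) t
  have h2 := criticalWeight_pos (Real.rpow_pos_of_pos hl.1 t)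
  rw [pressure, Real.exp_neg, Real.exp_log (div_pos h1 h2)]
  field_simp

theorem pressure_le_of_isTPConformal {lam : ℝ} (hl : lam ∈ Set.Ioo (0 : ℝ) 1) {t p : ℝ}
    {m : Measure X} (hm : IsTPConformal lam hl t p m) : pressure lam t ≤ p := by
  obtain ⟨hprob, hM⟩ := (isTPConformal_iff hl t p m).1 hm
  have h1 : 0 < (1 - lam) ^ t := Real.rpow_pos_of_pos (sub_pos.2 hl.2) t
  have hu := Real.rpow_pos_of_pos hl.1 t
  obtain ⟨h2, h3⟩ := hM.weight_le (mul_pos (Real.exp_pos _) h1) hu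
  have h4 := le_criticalWeight hu h2 h3
  rw [← exp_neg_pressure hl t, mul_le_mul_iff_left₀ h1, Real.exp_le_exp] at h4
  linarith

theorem exists_isTPConformal_pressure {lam : ℝ} (hl : lam ∈ Set.Ioo (0 : ℝ) 1) (t : ℝ) :
    ∃ m, IsTPConformal lam hl t (pressure lam t) m := by
  obtain ⟨s, hs⟩ := exists_isCascade_criticalWeight (Real.rpow_pos_of_pos hl.1 t)
  obtain ⟨m, hprob, hm⟩ := hs.exists_isMarkov (isCascade_pow hl)
  refine ⟨m, (isTPConformal_iff hl t _ m).2 ⟨hprob, ?_⟩⟩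
  rwa [exp_neg_pressure hl, F_eq_map hl]

theorem confPressure_eq {lam : ℝ} (hl : lam ∈ Set.Ioo (0 : ℝ) 1) (t : ℝ) :
    Dyn.confPressure (F lam hl) (Phi lam t) = (pressure lam t : EReal) := by
  refine IsLeast.csInf_eq ⟨⟨_, exists_isTPConformal_pressure hl t, rfl⟩, ?_⟩
  rintro _ ⟨p, ⟨m, hm⟩, rfl⟩
  exact EReal.coe_le_coe_iff.2 (pressure_le_of_isTPConformal hl hm)

theorem isDissipative_of_isTPConformal {lam : ℝ} (hl : lam ∈ Set.Ioo (0 : ℝ) 1) {t p : ℝ}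
    {m : Measure X} (hm : IsTPConformal lam hl t p m) (h : lam ^ t ≤ 1 / 2 → p ≠ pressure lam t) :
    Dyn.IsDissipative (F lam hl) m := by
  obtain ⟨hprob, hM⟩ := (isTPConformal_iff hl t p m).1 hm
  have h1 : 0 < (1 - lam) ^ t := Real.rpow_pos_of_pos (sub_pos.2 hl.2) t
  have hu := Real.rpow_pos_of_pos hl.1 t
  have ha : 0 < Real.exp (-p) * (1 - lam) ^ t := mul_pos (Real.exp_pos _) h1
  obtain ⟨h2, h3⟩ := hM.weight_le ha hu
  refine hM.isDissipative (weight_pos ha (mul_pos ha hu))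
    (summable_density_of_le_criticalWeight ha hu (le_criticalWeight hu h2 h3) fun hu2 heq => ?_)
  rw [← exp_neg_pressure hl t] at heq
  have := Real.exp_injective (mul_right_cancel₀ h1.ne' heq)
  exact h hu2 (neg_injective this)

theorem isConservative_of_isTPConformal {lam : ℝ} (hl : lam ∈ Set.Ioo (0 : ℝ) 1) {t : ℝ}
    {m : Measure X} (hm : IsTPConformal lam hl t (pressure lam t) m) (hu2 : lam ^ t ≤ 1 / 2) :
    Dyn.IsConservative (F lam hl) m := by
  obtain ⟨hprob, hM⟩ := (isTPConformal_iff hl t _ m).1 hm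
  have hu := Real.rpow_pos_of_pos hl.1 t
  rw [exp_neg_pressure hl, criticalWeight, if_pos hu2, mul_comm _ (lam ^ t)] at hM
  have h1u : 0 < 1 - lam ^ t := by linarith
  exact hM.isConservative (weight_pos h1u (mul_pos hu h1u)) (not_summable_density hu hu2)

end Cascade

theorem theoremA (lam : ℝ) (hl : lam ∈ Set.Ioo (0 : ℝ) 1) (t : ℝ) :
    (lam ^ t ≤ 1 / 2 →
      Dyn.confPressure (PLMap.F lam hl) (PLMap.Phi lam t)
        = ((Real.log (PLMap.psi lam t) : ℝ) : EReal)) ∧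
    (1 / 2 ≤ lam ^ t →
      Dyn.confPressure (PLMap.F lam hl) (PLMap.Phi lam t)
        = ((Real.log (4 * lam ^ t * (1 - lam) ^ t) : ℝ) : EReal)) ∧
    (∀ p : ℝ, (p : EReal) = Dyn.confPressure (PLMap.F lam hl) (PLMap.Phi lam t) →
      (∃ m : Measure PLMap.X, PLMap.IsTPConformal lam hl t p m) ∧
      ∀ m : Measure PLMap.X, PLMap.IsTPConformal lam hl t p m →
        (lam ^ t ≤ 1 / 2 → Dyn.IsConservative (PLMap.F lam hl) m) ∧
        (1 / 2 < lam ^ t → Dyn.IsDissipative (PLMap.F lam hl) m)) ∧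
    (∀ p : ℝ, (p : EReal) ≠ Dyn.confPressure (PLMap.F lam hl) (PLMap.Phi lam t) →
      ∀ m : Measure PLMap.X, PLMap.IsTPConformal lam hl t p m →
        Dyn.IsDissipative (PLMap.F lam hl) m) := by
  rw [Cascade.confPressure_eq hl t]
  refine ⟨fun hu => ?_, fun hu => ?_, fun p hp => ?_, fun p hp m hm => ?_⟩
  · rw [Cascade.pressure, Cascade.criticalWeight, if_pos hu, PLMap.psi]
  · have h0 := Real.rpow_pos_of_pos hl.1 t
    have e : Cascade.criticalWeight (lam ^ t) = 1 / (4 * lam ^ t) := by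
      rw [Cascade.criticalWeight]
      split_ifs with h
      · rw [le_antisymm h hu]
        norm_num
      · rfl
    rw [Cascade.pressure, e, div_div_eq_mul_div, div_one, mul_comm]
  · obtain rfl := EReal.coe_injective hp
    exact ⟨Cascade.exists_isTPConformal_pressure hl t, fun m hm =>
      ⟨Cascade.isConservative_of_isTPConformal hl hm, fun hu =>
        Cascade.isDissipative_of_isTPConformal hl hm fun hu2 => absurd hu (not_lt.2 hu2)⟩⟩
  · exact Cascade.isDissipative_of_isTPConformal hl hm fun _ h => hp (by rw [h])
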